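/- Let $f:\mathbb N\to\mathbb N$ be a function such that for every $m\in\mathbb N$ there exists $n\in\mathbb N$ with $|f(n_1)-f(n_2)|>m$ for all $n_1>n_2>n$. Let $\Sigma$ be a finite alphabet and $a\in\Sigma$. Then the language $L=\{a^{f(n)} : n\in\mathbb N\}\subseteq\Sigma^*$ does not have semi-linear Parikh image: the set $\{(|w|_x)_{x\in\Sigma} : w\in L\}\subseteq\mathbb N^{\Sigma}$, where $|w|_x$ is the number of occurrences of the letter $x$ in $w$, is not a finite union of sets of the form $\{v_0+\alpha_1v_1+\dots+\alpha_kv_k : \alpha_1,\dots,\alpha_k\in\mathbb N\}$ with $v_0,\dots,v_k\in\mathbb N^{\Sigma}$. Moreover, $L$ is not multiple context-free, that is, $L$ is not the language of any multiple context-free grammar. Here $\mathbb N=\{0,1,2,\dots\}$. A multiple context-free grammar has finitely many non-terminals, each with a rank (its number of components), a start non-terminal $S$ of rank $1$, and finitely many rules $A(s_1,\dots,s_m)\leftarrow B_1(x^1_1,\dots,x^1_{k_1}),\dots,B_n(x^n_1,\dots,x^n_{k_n})$ with $n\ge 0$, where $A,B_1,\dots,B_n$ are non-terminals of ranks $m,k_1,\dots,k_n$,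 the $x^i_j$ are distinct variables, and $s_1,\dots,s_m$ are strings of letters of $\Sigma$ and variables $x^i_j$ such that each variable occurs at most once in $s_1\cdots s_m$. A rule produces a value of $A$ (a tuple of words) by substituting, for the variables, already produced values of $B_1,\dots,B_n$; the language of the grammar is the set of words $w\in\Sigma^*$ such that $(w)$ can be produced as a value of $S$. -/

import Mathlib

/-- A rule `A(s₁, …, sₘ) ← B₁(x¹), …, Bₙ(xⁿ)` of a multiple context-free grammar with terminals `T`
and non-terminals `N`, where `rank A` is the number of components of the non-terminal `A`.
The variable `xⁱⱼ`, the `j`-th component of the `i`-th non-terminal of the right-hand side, is the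
pair `⟨i, j⟩`. Initialising rules `A(t₁, …, tₘ) ←` are those with `arity = 0`. -/
structure MCFRule (T : Type*) (N : Type) (rank : N → ℕ) where
  /-- The non-terminal `A`. -/
  head : N
  /-- The number `n` of non-terminals on the right-hand side. -/
  arity : ℕ
  /-- The non-terminals `B₁, …, Bₙ`. -/
  body : Fin arity → N
  /-- The strings `s₁, …, sₘ` of terminals and variables. -/
  template : Fin (rank head) → List (T ⊕ (Σ i : Fin arity, Fin (rank (body i))))
  /-- Each variable occurs at most once in the concatenation `s₁ ⋯ sₘ`. -/
  linear : ((List.ofFn template).flatten.filterMap Sum.getRight?).Nodup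

/-- The tuple of words obtained from `(s₁, …, sₘ)` by substituting the words `x i j` for the
variables `⟨i, j⟩`. -/
def MCFRule.eval {T : Type*} {N : Type} {rank : N → ℕ} (r : MCFRule T N rank)
    (x : (i : Fin r.arity) → Fin (rank (r.body i)) → List T) : Fin (rank r.head) → List T :=
  fun j => (r.template j).flatMap (Sum.elim (fun t => [t]) (fun v => x v.1 v.2))

/-- A multiple context-free grammar with terminals `T`. -/
structure MCFGrammar (T : Type*) where
  /-- The non-terminals. -/
  NT : Type
  /-- There are finitely many non-terminals. -/
  finite_NT : Finite NT
  /-- The rank of each non-terminal. -/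
  rank : NT → ℕ
  /-- The start non-terminal. -/
  start : NT
  /-- The start non-terminal has rank one. -/
  rank_start : rank start = 1
  /-- The rules. -/
  rules : Set (MCFRule T NT rank)
  /-- There are finitely many rules. -/
  finite_rules : rules.Finite

/-- `G.Derives A u`: the tuple of words `u` can be obtained as a value of the non-terminal `A` by
applying rules of `G`, from the leaves of a derivation tree to its root. -/
inductive MCFGrammar.Derives {T : Type*} (G : MCFGrammar T) :
    (A : G.NT) → (Fin (G.rank A) → List T) → Prop
  | rule (r : MCFRule T G.NT G.rank) (hr : r ∈ G.rules)
      (x : (i : Fin r.arity) → Fin (G.rank (r.body i)) → List T)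
      (hx : ∀ i, MCFGrammar.Derives G (r.body i) (x i)) :
      MCFGrammar.Derives G r.head (r.eval x)

/-- The language of `G`: all words `w` such that `S(w)` can be obtained, where `S` is the start
non-terminal (of rank one, so that `fun _ => w` is the one-component tuple `(w)`). -/
def MCFGrammar.language {T : Type*} (G : MCFGrammar T) : Language T :=
  {w : List T | G.Derives G.start (fun _ => w)}

/-- `L` is `k`-multiple context-free: it is the language of a multiple context-free grammar all of
whose non-terminals have rank at most `k`. -/
def IsKMultipleContextFree {T : Type*} (k : ℕ) (L : Language T) : Prop :=
  ∃ G : MCFGrammar T, (∀ A, G.rank A ≤ k) ∧ G.language = L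

/-- `L` is multiple context-free: it is `k`-multiple context-free for some `k ≥ 1`. -/
def IsMultipleContextFree {T : Type*} (L : Language T) : Prop :=
  ∃ k : ℕ, 1 ≤ k ∧ IsKMultipleContextFree k L

/-- The Parikh map: it sends a word `w` to the vector of the numbers of occurrences in `w` of each
letter of the alphabet. -/
def parikhMap {T : Type*} [DecidableEq T] (w : List T) : T → ℕ :=
  fun t => w.count t

/-- The Parikh image of a language. -/
def parikhImage {T : Type*} [DecidableEq T] (L : Language T) : Set (T → ℕ) :=
  {v : T → ℕ | ∃ w ∈ L, parikhMap w = v}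

/-- The language `{a ^ f(n) : n ∈ ℕ}`. -/
def powerLanguage {T : Type*} (a : T) (f : ℕ → ℕ) : Language T :=
  {w : List T | ∃ n : ℕ, w = List.replicate (f n) a}

/-! Both halves reduce to one fact: the range of `f` is infinite but contains no infinite arithmetic
progression, since gaps eventually exceed any common difference. A semilinear Parikh image would
project to a semilinear, hence ultimately periodic, subset of `ℕ`, and an infinite such set contains
a progression. For a grammar, only word lengths matter. As variables are never copied, the total
length of a set `S` of components is a constant plus total lengths of sets of components of the
body. Taking pairs `(A, S)` as non-terminals (sets, because rules may drop variables) gives a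
context-free system over `ℕ`, where pumping shows that the values are bounded or contain a
progression (`bounded_or_pumpable`). -/

/-- A word in terminals and variables, after substitution of the variables, has length the number
of its terminals plus the lengths of the words substituted, counted with multiplicity. -/
theorem List.length_flatMap_sumElim {T V : Type*} [Fintype V] [DecidableEq V]
    (l : List (T ⊕ V)) (x : V → List T) :
    (l.flatMap (Sum.elim (fun t => [t]) x)).length =
      (l.filterMap Sum.getLeft?).length +
        ∑ v, (l.filterMap Sum.getRight?).count v * (x v).length := by
  induction l with
  | nil => simp
  | cons s l ih =>
    rw [List.flatMap_cons, List.length_append, ih]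
    cases s with
    | inl t =>
      simp [List.filterMap_cons]
      omega
    | inr v =>
      simp [List.filterMap_cons, List.count_cons, add_mul, Finset.sum_add_distrib]
      omega

/-! ### Pumping in additive systems -/

/-- A context-free system of productions over `ℕ` : a production `i` yields a value of `head i` by
adding the constant `const i` to the sum of values of the `body i k`. -/
structure AdditiveSystem (Q ι : Type*) where
  /-- The non-terminal that a production yields a value of. -/
  head : ι → Q
  /-- The number of non-terminals used by a production. -/
  arity : ι → ℕ
  /-- The non-terminals used by a production. -/
  body : (i : ι) → Fin (arity i) → Q
  /-- The constant added by a production. -/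
  const : ι → ℕ

namespace AdditiveSystem

variable {Q ι : Type*} (G : AdditiveSystem Q ι)

/-- `G.DerivesAvoiding P q n`: the number `n` is a value of `q` by a derivation tree in which, for
every node, the non-terminal at the node is outside `P`. -/
inductive DerivesAvoiding (P : Set Q) : Q → ℕ → Prop
  | prod (i : ι) (hi : G.head i ∉ P) (x : Fin (G.arity i) → ℕ)
      (hx : ∀ k, DerivesAvoiding P (G.body i k) (x k)) :
      DerivesAvoiding P (G.head i) (G.const i + ∑ k, x k)

variable {G}

theorem DerivesAvoiding.mono {P P' : Set Q} (h : P ⊆ P') {q : Q} {n : ℕ}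
    (hq : G.DerivesAvoiding P' q n) : G.DerivesAvoiding P q n := by
  induction hq with
  | prod i hi x _ ih => exact .prod i (fun h' => hi (h h')) x ih

theorem DerivesAvoiding.notMem {P : Set Q} {q : Q} {n : ℕ} (hq : G.DerivesAvoiding P q n) :
    q ∉ P := by
  cases hq with
  | prod i hi => exact hi

variable (G) in
/-- From every value of `q` one obtains a value of `p` that is larger by `d`. -/
def Shift (p q : Q) (d : ℕ) : Prop :=
  ∀ n, G.DerivesAvoiding ∅ q n → G.DerivesAvoiding ∅ p (d + n)

theorem Shift.refl (p : Q) : G.Shift p p 0 := fun n hn => by simpa using hn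

theorem Shift.trans {p q r : Q} {d e : ℕ} (h : G.Shift p q d) (h' : G.Shift q r e) :
    G.Shift p r (d + e) := fun n hn => by
  rw [add_assoc]; exact h _ (h' n hn)

theorem Shift.iterate {q : Q} {d : ℕ} (h : G.Shift q q d) (k : ℕ) : G.Shift q q (k * d) := by
  induction k with
  | zero => simpa using Shift.refl q
  | succ k ih => simpa [add_mul] using ih.trans h

theorem Shift.of_prod (i : ι) (x : Fin (G.arity i) → ℕ)
    (hx : ∀ k, G.DerivesAvoiding ∅ (G.body i k) (x k)) (k : Fin (G.arity i)) :
    G.Shift (G.head i) (G.body i k) (G.const i + ∑ j ∈ Finset.univ.erase k, x j) := by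
  intro n hn
  have h := DerivesAvoiding.prod (P := ∅) i (by simp) (Function.update x k n) (fun j => by
    by_cases hj : j = k
    · subst hj; simpa using hn
    · simpa [hj] using hx j)
  convert h using 1
  rw [add_assoc, ← Finset.sum_erase_add _ _ (Finset.mem_univ k)]
  congr 2
  · exact Finset.sum_congr rfl fun j hj => by simp [Finset.ne_of_mem_erase hj]
  · simp

/-- A derivation tree either avoids `q`, or has a lowest node with the non-terminal `q`. -/
theorem DerivesAvoiding.insert_or_exists_lowest {P : Set Q} (q : Q) {p : Q} {n : ℕ}
    (hp : G.DerivesAvoiding P p n) :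
    G.DerivesAvoiding (insert q P) p n ∨
      ∃ d n', n = d + n' ∧ G.Shift p q d ∧ ∃ i, ∃ x : Fin (G.arity i) → ℕ, G.head i = q ∧
        (∀ k, G.DerivesAvoiding (insert q P) (G.body i k) (x k)) ∧
        n' = G.const i + ∑ k, x k := by
  induction hp with
  | prod i hi x hx ih =>
    by_cases h : ∀ k, G.DerivesAvoiding (insert q P) (G.body i k) (x k)
    · by_cases hq : G.head i = q
      · exact .inr ⟨0, _, by simp, hq ▸ Shift.refl _, i, x, hq, h, rfl⟩
      · exact .inl (.prod i (by simp [hq, hi]) x h)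
    · push Not at h
      obtain ⟨k, hk⟩ := h
      obtain ⟨d, n', hn, hd, hroot⟩ := (ih k).resolve_left hk
      refine .inr ⟨_, n', ?_,
        (Shift.of_prod i x (fun k => (hx k).mono (Set.empty_subset _)) k).trans hd, hroot⟩
      rw [← Finset.sum_erase_add _ _ (Finset.mem_univ k), hn]
      ring

/-- Induction on the number of non-terminals outside `P`. Cutting a tree at a lowest occurrence of
its root label `q` removes a loop at `q`, which adds `0` by hypothesis; below the cut, the subtrees
also avoid `q`. -/
theorem exists_bound_of_not_pumpable [Finite Q] [Finite ι] {s : Q}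
    -- The existence of a value matters: if `q` has none, `Shift q q d` holds vacuously for every
    -- `d`.
    (hs : ∀ q e d, G.Shift s q e → G.Shift q q d → (∃ n, G.DerivesAvoiding ∅ q n) → d = 0)
    (P : Set Q) :
    ∃ b, ∀ q e n, G.Shift s q e → G.DerivesAvoiding P q n → n ≤ b := by
  induction hc : Pᶜ.ncard using Nat.strong_induction_on generalizing P with
  | _ c ih =>
  have hb : ∀ q : Q, ∃ b, q ∉ P →
      ∀ q' e n, G.Shift s q' e → G.DerivesAvoiding (insert q P) q' n → n ≤ b := by
    intro q
    by_cases hq : q ∈ P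
    · exact ⟨0, fun h => absurd hq h⟩
    · obtain ⟨b, hb⟩ := ih _ (hc ▸ Set.ncard_lt_ncard (compl_lt_compl_iff_lt.2
        (Set.ssubset_insert hq)) (Set.toFinite _)) (insert q P) rfl
      exact ⟨b, fun _ => hb⟩
  choose b hb using hb
  -- The production at the cut determines the bound: its constant plus one inductive bound per
  -- child.
  obtain ⟨B, hB⟩ := (Set.finite_range fun i =>
    G.const i + G.arity i * b (G.head i)).bddAbove
  refine ⟨B, fun q e n he hn => ?_⟩
  obtain h | ⟨d, n', rfl, hd, i, x, rfl, hx, rfl⟩ := hn.insert_or_exists_lowest q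
  · exact absurd (Set.mem_insert _ _) h.notMem
  · obtain rfl := hs _ e d he hd ⟨_, hn.mono (Set.empty_subset _)⟩
    refine le_trans ?_ (hB ⟨i, rfl⟩)
    have hx' := fun k => (hx k).mono (Set.empty_subset _)
    have := Finset.sum_le_card_nsmul Finset.univ x (b (G.head i)) fun k _ =>
      hb _ hn.notMem _ _ _ (he.trans (Shift.of_prod i x hx' k)) (hx k)
    simpa using this

/-- The set of values of a non-terminal is bounded or contains an infinite arithmetic
progression. -/
theorem bounded_or_pumpable [Finite Q] [Finite ι] (s : Q) :
    (∃ b, ∀ n, G.DerivesAvoiding ∅ s n → n ≤ b) ∨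
      ∃ c d, 0 < d ∧ ∀ k, G.DerivesAvoiding ∅ s (c + k * d) := by
  by_cases hs : ∀ q e d, G.Shift s q e → G.Shift q q d → (∃ n, G.DerivesAvoiding ∅ q n) → d = 0
  · obtain ⟨b, hb⟩ := exists_bound_of_not_pumpable hs ∅
    exact .inl ⟨b, fun n => hb s 0 n (Shift.refl s)⟩
  · push Not at hs
    obtain ⟨q, e, d, he, hd, ⟨n, hn⟩, h0⟩ := hs
    refine .inr ⟨e + n, d, Nat.pos_of_ne_zero h0, fun k => ?_⟩
    have := (he.trans (hd.iterate k)) n hn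
    rwa [add_right_comm] at this

end AdditiveSystem

/-! ### From grammars to lengths -/

namespace MCFRule

variable {T : Type*} {N : Type} {rank : N → ℕ} (r : MCFRule T N rank)

open scoped Classical in
/-- The components of the `i`-th non-terminal of the right-hand side that occur in the components
in `S` of the left-hand side. -/
noncomputable def used (S : Finset (Fin (rank r.head))) (i : Fin r.arity) :
    Finset (Fin (rank (r.body i))) :=
  {j | ∃ s ∈ S, ⟨i, j⟩ ∈ (r.template s).filterMap Sum.getRight?}

open scoped Classical in
theorem sum_count_le_one (S : Finset (Fin (rank r.head)))
    (v : Σ i : Fin r.arity, Fin (rank (r.body i))) :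
    ∑ s ∈ S, ((r.template s).filterMap Sum.getRight?).count v ≤ 1 := by
  refine le_trans (Finset.sum_le_univ_sum_of_nonneg fun _ => Nat.zero_le _) ?_
  have h := List.nodup_iff_count_le_one.1 r.linear v
  rw [List.filterMap_flatten, List.count_flatten, List.map_map, List.map_ofFn,
    List.sum_ofFn] at h
  exact h

-- Linearity of the rule enters here: it makes lengths add without multiplicities.
open scoped Classical in
theorem sum_count_eq_ite (S : Finset (Fin (rank r.head)))
    (v : Σ i : Fin r.arity, Fin (rank (r.body i))) :
    ∑ s ∈ S, ((r.template s).filterMap Sum.getRight?).count v =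
      if v.2 ∈ r.used S v.1 then 1 else 0 := by
  split_ifs with h
  · refine le_antisymm (r.sum_count_le_one S v) ?_
    simp only [used, Finset.mem_filter, Finset.mem_univ, true_and] at h
    obtain ⟨s, hs, hv⟩ := h
    exact (List.count_pos_iff.2 hv).trans_le
      (Finset.single_le_sum (f := fun s => ((r.template s).filterMap Sum.getRight?).count v)
        (fun _ _ => Nat.zero_le _) hs)
  · simp only [used, Finset.mem_filter, Finset.mem_univ, true_and, not_exists, not_and] at h
    exact Finset.sum_eq_zero fun s hs => List.count_eq_zero.2 (h s hs)

/-- The total length of the components in `S` of a value depends only on the total lengths of the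
components used. -/
theorem sum_length_eval (S : Finset (Fin (rank r.head)))
    (x : (i : Fin r.arity) → Fin (rank (r.body i)) → List T) :
    ∑ s ∈ S, (r.eval x s).length =
      ∑ s ∈ S, ((r.template s).filterMap Sum.getLeft?).length +
        ∑ i, ∑ j ∈ r.used S i, (x i j).length := by
  classical
  simp only [eval, List.length_flatMap_sumElim _
    (fun v : Σ i : Fin r.arity, Fin (rank (r.body i)) => x v.1 v.2), Finset.sum_add_distrib]
  rw [Finset.sum_comm]
  simp only [← Finset.sum_mul, sum_count_eq_ite, Fintype.sum_sigma, ite_mul, one_mul, zero_mul,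
    Finset.sum_ite_mem, Finset.univ_inter]

end MCFRule

namespace MCFGrammar

variable {T : Type*} (G : MCFGrammar T)

/-- The system that computes the total lengths of selected components of the values of the
non-terminals of `G`. -/
noncomputable def lengthSystem : AdditiveSystem (Σ A : G.NT, Finset (Fin (G.rank A)))
    (Σ r : G.rules, Finset (Fin (G.rank r.1.head))) where
  head i := ⟨i.1.1.head, i.2⟩
  arity i := i.1.1.arity
  body i k := ⟨i.1.1.body k, i.1.1.used i.2 k⟩
  const i := ∑ s ∈ i.2, ((i.1.1.template s).filterMap Sum.getLeft?).length

variable {G}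

theorem Derives.lengthSystem {A : G.NT} {u : Fin (G.rank A) → List T} (h : G.Derives A u)
    (S : Finset (Fin (G.rank A))) :
    G.lengthSystem.DerivesAvoiding ∅ ⟨A, S⟩ (∑ s ∈ S, (u s).length) := by
  induction h with
  | rule r hr x _ ih =>
    rw [r.sum_length_eval]
    exact .prod (G := G.lengthSystem) ⟨⟨r, hr⟩, S⟩ (by simp) _ fun k => ih k _

theorem exists_derives_of_lengthSystem {q : Σ A : G.NT, Finset (Fin (G.rank A))} {n : ℕ}
    (h : G.lengthSystem.DerivesAvoiding ∅ q n) :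
    ∃ u, G.Derives q.1 u ∧ ∑ s ∈ q.2, (u s).length = n := by
  induction h with
  | prod i _ x _ ih =>
    choose u hu hux using ih
    refine ⟨_, .rule i.1.1 i.1.2 u hu, ?_⟩
    refine (i.1.1.sum_length_eval i.2 u).trans ?_
    exact congrArg _ (Finset.sum_congr rfl fun k _ => hux k)

theorem exists_mem_language_length_iff (n : ℕ) :
    (∃ w ∈ G.language, w.length = n) ↔
      G.lengthSystem.DerivesAvoiding ∅ ⟨G.start, Finset.univ⟩ n := by
  have hcard : (Finset.univ : Finset (Fin (G.rank G.start))).card = 1 := by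
    simp [G.rank_start]
  have : Subsingleton (Fin (G.rank G.start)) := by rw [G.rank_start]; infer_instance
  constructor
  · rintro ⟨w, hw, rfl⟩
    simpa [hcard, G.rank_start] using Derives.lengthSystem hw Finset.univ
  · intro h
    obtain ⟨u, hu, rfl⟩ := exists_derives_of_lengthSystem h
    have hu' : u = fun _ => u ⟨0, by simp [G.rank_start]⟩ :=
      funext fun _ => congrArg u (Subsingleton.elim _ _)
    refine ⟨_, show G.Derives G.start _ from hu' ▸ hu, ?_⟩
    rw [hu']
    simp [G.rank_start]

/-- The lengths of the words of a multiple context-free language are bounded or contain an infinite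
arithmetic progression. -/
theorem length_bounded_or_pumpable (G : MCFGrammar T) :
    (∃ b, ∀ w ∈ G.language, w.length ≤ b) ∨
      ∃ c d, 0 < d ∧ ∀ k, ∃ w ∈ G.language, w.length = c + k * d := by
  have := G.finite_NT
  have : Finite G.rules := G.finite_rules
  obtain ⟨b, hb⟩ | h :=
    G.lengthSystem.bounded_or_pumpable (⟨G.start, Finset.univ⟩ : Σ A, Finset (Fin (G.rank A)))
  · exact .inl ⟨b, fun w hw => hb _ ((exists_mem_language_length_iff _).1 ⟨w, hw, rfl⟩)⟩
  · simpa only [exists_mem_language_length_iff] using Or.inr h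

end MCFGrammar

/-! ### Sequences with growing gaps -/

/-- The range of a sequence with growing gaps contains no infinite arithmetic progression. -/
theorem not_forall_progression_mem_range {f : ℕ → ℕ}
    (hf : ∀ m : ℕ, ∃ n : ℕ, ∀ n₁ n₂ : ℕ, n₁ > n₂ → n₂ > n → |(f n₁ : ℤ) - (f n₂ : ℤ)| > (m : ℤ))
    {c d : ℕ} (hd : 0 < d) : ¬ ∀ k, c + k * d ∈ Set.range f := by
  intro h
  choose g hg using h
  have hinj : Function.Injective g := fun i j hij => by
    have := (hg i).symm.trans ((congrArg f hij).trans (hg j))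
    exact Nat.eq_of_mul_eq_mul_right hd (Nat.add_left_cancel this)
  obtain ⟨n, hn⟩ := hf d
  have hg' : Filter.Tendsto g Filter.atTop Filter.atTop := hinj.nat_tendsto_atTop
  obtain ⟨k, hk⟩ := Filter.eventually_atTop.1 (hg'.eventually_gt_atTop n)
  have h1 := hk k le_rfl
  have h2 := hk (k + 1) (Nat.le_succ k)
  have e1 : (f (g k) : ℤ) = c + k * d := by exact_mod_cast hg k
  have e2 : (f (g (k + 1)) : ℤ) = c + (k + 1) * d := by exact_mod_cast hg (k + 1)
  -- The indices of consecutive terms may come in either order; both exceed `n`, yet the values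
  -- differ by exactly `d`.
  rcases lt_or_gt_of_ne (hinj.ne (Nat.succ_ne_self k)) with hlt | hlt
  · have := hn _ _ hlt h2
    rw [e1, e2, abs_sub_comm, show (c + (k + 1) * d - (c + k * d) : ℤ) = d by ring,
      abs_of_nonneg (by positivity)] at this
    exact lt_irrefl _ this
  · have := hn _ _ hlt h1
    rw [e1, e2, show (c + (k + 1) * d - (c + k * d) : ℤ) = d by ring,
      abs_of_nonneg (by positivity)] at this
    exact lt_irrefl _ this

/-- The range of a sequence with growing gaps is infinite. -/
theorem infinite_range_of_gaps {f : ℕ → ℕ}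
    (hf : ∀ m : ℕ, ∃ n : ℕ, ∀ n₁ n₂ : ℕ, n₁ > n₂ → n₂ > n →
      |(f n₁ : ℤ) - (f n₂ : ℤ)| > (m : ℤ)) : (Set.range f).Infinite := by
  obtain ⟨n, hn⟩ := hf 0
  have hinj : Function.Injective fun k => f (n + 1 + k) := by
    refine .of_lt_imp_ne fun i j hij h => ?_
    have := hn (n + 1 + j) (n + 1 + i) (by omega) (by omega)
    simp [h] at this
  exact (Set.infinite_range_of_injective hinj).mono
    (Set.range_subset_iff.2 fun k => ⟨_, rfl⟩)

theorem image_eval_parikhImage_powerLanguage {T : Type*} [DecidableEq T] (a : T) (f : ℕ → ℕ) :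
    Pi.evalAddMonoidHom (fun _ : T => ℕ) a '' parikhImage (powerLanguage a f) = Set.range f := by
  ext m
  constructor
  · rintro ⟨_, ⟨_, ⟨n, rfl⟩, rfl⟩, rfl⟩
    exact ⟨n, by simp [parikhMap]⟩
  · rintro ⟨n, rfl⟩
    exact ⟨_, ⟨_, ⟨n, rfl⟩, rfl⟩, by simp [parikhMap]⟩

theorem mainTheorem9 {T : Type*} [Finite T] [DecidableEq T] (a : T) (f : ℕ → ℕ)
    (hf : ∀ m : ℕ, ∃ n : ℕ, ∀ n₁ n₂ : ℕ, n₁ > n₂ → n₂ > n →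
      |(f n₁ : ℤ) - (f n₂ : ℤ)| > (m : ℤ)) :
    ¬ IsSemilinearSet (parikhImage (powerLanguage a f)) ∧
      ¬ IsMultipleContextFree (powerLanguage a f) := by
  constructor
  · intro h
    have h' := h.image (Pi.evalAddMonoidHom (fun _ : T => ℕ) a)
    rw [image_eval_parikhImage_powerLanguage, Nat.isSemilinearSet_iff_ultimately_periodic] at h'
    obtain ⟨k, p, hp, hper⟩ := h'
    -- A value beyond the threshold `k` starts a progression with the period `p` as difference.
    obtain ⟨c, hc, hkc⟩ := (infinite_range_of_gaps hf).exists_gt k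
    refine not_forall_progression_mem_range hf hp (c := c) fun i => ?_
    induction i with
    | zero => simpa using hc
    | succ i ih =>
      rw [add_mul, one_mul, ← add_assoc]
      exact (hper _ (by omega)).1 ih
  · rintro ⟨-, -, G, -, hG⟩
    obtain ⟨b, hb⟩ | ⟨c, d, hd, h⟩ := G.length_bounded_or_pumpable
    · obtain ⟨_, ⟨n, rfl⟩, hn⟩ := (infinite_range_of_gaps hf).exists_gt b
      have := hb (List.replicate (f n) a) (hG ▸ ⟨n, rfl⟩)
      rw [List.length_replicate] at this
      omega
    · refine not_forall_progression_mem_range hf hd (c := c) fun k => ?_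
      obtain ⟨w, hw, hlen⟩ := h k
      rw [hG] at hw
      obtain ⟨n, rfl⟩ := hw
      exact ⟨n, by simpa using hlen⟩
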